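/- For $R>0$ let $B_R\subset\mathbb R^3$ be the open ball of radius $R$ centered at the origin. Let $j:\mathbb R^3\to[0,+\infty]$ be Borel measurable and finite almost everywhere, and assume that $$Q_{B_R}:=\operatorname*{ess\,inf}_{|z|<2R} j(z)>0 .$$ Let $L^2(B_R;\mathbb S^2)$ be the set of $m\in L^2(B_R;\mathbb R^3)$ with $|m|=1$ a.e. in $B_R$, let $$\mathcal J_{B_R}(m)=\iint_{B_R\times B_R} j(x-y)\,|m(x)-m(y)|^2\,dx\,dy\in[0,+\infty],\qquad \mathcal X^j(B_R;\mathbb S^2)=\{m\in L^2(B_R;\mathbb S^2):\mathcal J_{B_R}(m)<+\infty\},$$ and, for $m\in L^2(B_R;\mathbb R^3)$, let $h_d[m]\in L^2(\mathbb R^3;\mathbb R^3)$ be the solution, in the sense of distributions on $\mathbb R^3$, of $$\operatorname{div}(m\chi_{B_R}+h_d[m])=0,\qquad \operatorname{curl} h_d[m]=0,$$ where $m\chi_{B_R}$ is the extension of $m$ by zero. On $\mathcal X^j(B_R;\mathbb S^2)$ consider the energy $$\mathcal E_{B_R}(m)=\mathcal J_{B_R}(m)-\int_{B_R}h_d[m]\cdot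 m\,dx .$$ Assume that $C_R:=\dfrac{1}{Q_{B_R}|B_R|}<3$. Then $h_d[m]$ is well defined, i.e. for every $m\in L^2(B_R;\mathbb R^3)$ the above system has exactly one solution in $L^2(\mathbb R^3;\mathbb R^3)$; the energy $\mathcal E_{B_R}$ has a minimizer in $\mathcal X^j(B_R;\mathbb S^2)$; and the minimizers of $\mathcal E_{B_R}$ in $\mathcal X^j(B_R;\mathbb S^2)$ are exactly the constant maps, i.e. $m$ is a minimizer if and only if there is $\sigma\in\mathbb S^2$ with $m=\sigma$ a.e. in $B_R$. -/

import Mathlib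

open MeasureTheory
open scoped ENNReal ContDiff

noncomputable section

namespace Micromagnetics

/-- Three-dimensional Euclidean space `ℝ³`. -/
abbrev E3 : Type := EuclideanSpace ℝ (Fin 3)

/-- `L²(Ω; ℝ³)`. -/
abbrev L2 (Ω : Set E3) : Type := Lp E3 2 (volume.restrict Ω)

/-- `L²(Ω; 𝕊²)`: the square-integrable fields with values in the unit sphere a.e. in `Ω`. -/
def L2Sphere (Ω : Set E3) : Set (L2 Ω) :=
  {m | ∀ᵐ x ∂(volume.restrict Ω), m x ∈ Metric.sphere (0 : E3) 1}

/-- The nonlocal exchange energy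
`𝓙_Ω(m) = ∬_{Ω × Ω} j(x - y) |m(x) - m(y)|² dx dy ∈ [0, ∞]`. -/
def exchangeEnergy (j : E3 → ℝ≥0∞) (Ω : Set E3) (m : L2 Ω) : ℝ≥0∞ :=
  ∫⁻ x in Ω, ∫⁻ y in Ω, j (x - y) * ‖m x - m y‖ₑ ^ 2

/-- `𝓧^j(Ω; 𝕊²)`: the fields in `L²(Ω; 𝕊²)` of finite exchange energy. -/
def admissible (j : E3 → ℝ≥0∞) (Ω : Set E3) : Set (L2 Ω) :=
  {m | m ∈ L2Sphere Ω ∧ exchangeEnergy j Ω m < ⊤}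

/-- The partial derivative `∂ᵢ φ (x)` of a scalar function on `ℝ³`. -/
def partialDeriv (i : Fin 3) (φ : E3 → ℝ) (x : E3) : ℝ :=
  fderiv ℝ φ x (EuclideanSpace.single i 1)

/-- `h ∈ L²(ℝ³; ℝ³)` solves, in the sense of distributions on `ℝ³`, the equations of
magnetostatics `div (m χ_Ω + h) = 0` and `curl h = 0`. The second equation is written
componentwise: `∂ⱼ hᵢ - ∂ᵢ hⱼ = 0` for all `i`, `j`. -/
structure IsStrayField (Ω : Set E3) (m : L2 Ω) (h : Lp E3 2 (volume : Measure E3)) : Prop where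
  div_eq_zero : ∀ φ : E3 → ℝ, ContDiff ℝ ∞ φ → HasCompactSupport φ →
    ∫ x, ∑ i : Fin 3, (Ω.indicator m x + h x) i * partialDeriv i φ x = 0
  curl_eq_zero : ∀ φ : E3 → ℝ, ContDiff ℝ ∞ φ → HasCompactSupport φ → ∀ i j : Fin 3,
    ∫ x, (h x i * partialDeriv j φ x - h x j * partialDeriv i φ x) = 0

/-- The demagnetizing (stray) field `h_d[m] ∈ L²(ℝ³; ℝ³)`: the solution in `L²(ℝ³; ℝ³)` of the
equations of magnetostatics (the system always has exactly one). -/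
def strayField (Ω : Set E3) (m : L2 Ω) : Lp E3 2 (volume : Measure E3) :=
  Classical.epsilon (IsStrayField Ω m)

/-- The magnetostatic self-energy `𝓦_Ω(m) = -∫_Ω h_d[m] · m dx`. -/
def magnetostaticEnergy (Ω : Set E3) (m : L2 Ω) : ℝ :=
  -∫ x in Ω, inner ℝ (strayField Ω m x) (m x)

/-- The micromagnetic energy `𝓔_Ω(m) = 𝓙_Ω(m) + 𝓦_Ω(m)`. It is only used on `𝓧^j(Ω; 𝕊²)`, where
`𝓙_Ω(m)` is finite. -/
def energy (j : E3 → ℝ≥0∞) (Ω : Set E3) (m : L2 Ω) : ℝ :=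
  (exchangeEnergy j Ω m).toReal + magnetostaticEnergy Ω m

/-- `m` is a minimizer of `𝓔_Ω` in `𝓧^j(Ω; 𝕊²)`. -/
def IsMinimizer (j : E3 → ℝ≥0∞) (Ω : Set E3) (m : L2 Ω) : Prop :=
  m ∈ admissible j Ω ∧ IsMinOn (energy j Ω) (admissible j Ω) m

/-- `Q_Ω = ess inf_{|z| < diam Ω} j(z) ∈ [0, ∞]`. -/
def kernelInf (j : E3 → ℝ≥0∞) (Ω : Set E3) : ℝ≥0∞ :=
  essInf j (volume.restrict {z : E3 | ‖z‖ < Metric.diam Ω})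

/-- The constant `1 / (Q_Ω |Ω|)` of the Poincaré-type inequality. -/
def poincareConst (j : E3 → ℝ≥0∞) (Ω : Set E3) : ℝ≥0∞ :=
  1 / (kernelInf j Ω * volume Ω)

end Micromagnetics

end

/-! Let `V` be the volume of the ball and `M` the integral of `m` over it. The proof compares both
energy terms with the number `‖M‖`.

Stray field: the two equations say that `m χ + h` is orthogonal in `L²` to gradients of test
functions and that `h` is orthogonal to curls. Since gradients and curls are mutually orthogonal, `h
= -P (m χ)` is a solution, where `P` projects onto the closure of the gradients. An `L²` field
orthogonal to both families has harmonic components, and the Fourier transform shows that it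
vanishes, so the solution is unique (`strayField_eq`).

Magnetostatic part: the energy is the quadratic form `⟨P m, m⟩`, which is nonnegative, hence convex
and above its tangent at any constant field. On a ball the stray field of a constant `σ` is `-σ/3`
inside (`strayField_ball`). Taking the tangent at the average `M / V` gives the lower bound `‖M‖² /
(3V)` (`le_magnetostaticEnergy`).

Exchange part: `|x - y| < 2R` in the ball, so the exchange energy is at least `Q ∬ |m(x) - m(y)|² =
2Q (V² - ‖M‖²)`, because `|m| = 1`.

The assumption gives `Q ≥ 1/(3V)`, and the two bounds add up to `V/3 + (V² - ‖M‖²)/(3V)`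
(`le_energy`). Constants have energy exactly `V/3`, and `‖M‖ ≤ V`, so they are minimizers. Equality
forces `‖M‖ = V`, and then `∫ |M/V - m|² = 0`. -/

namespace Micromagnetics

open Filter Topology LineDeriv Laplacian FourierTransform
open scoped SchwartzMap

/-! ### Uniqueness for the div-curl system in `L²` -/

/-- An `L²` function whose distributional Laplacian vanishes is zero. -/
theorem eq_zero_of_laplacian_eq_zero (u : Lp ℂ 2 (volume : Measure E3))
    (hu : Δ (u : 𝓢'(E3, ℂ)) = 0) : u = 0 := by
  have h1 := TemperedDistribution.laplacian_eq_fourierMultiplierCLM (u : 𝓢'(E3, ℂ))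
  rw [hu, TemperedDistribution.fourierMultiplierCLM_apply,
    Lp.fourier_toTemperedDistribution_eq] at h1
  have hpi : (-(2 * Real.pi) ^ 2 : ℝ) ≠ 0 := by
    have := Real.pi_pos
    simp [this.ne']
  have h2 := (smul_eq_zero_iff_right hpi).1 h1.symm
  have h3 : TemperedDistribution.smulLeftCLM ℂ (fun x : E3 ↦ Complex.ofReal (‖x‖ ^ 2))
      ((𝓕 u : Lp ℂ 2 (volume : Measure E3)) : 𝓢'(E3, ℂ)) = 0 := by
    have := congrArg (fun T : 𝓢'(E3, ℂ) ↦ 𝓕 T) h2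
    simpa using this
  set v : Lp ℂ 2 (volume : Measure E3) := 𝓕 u with hv
  have hg : (fun x : E3 ↦ Complex.ofReal (‖x‖ ^ 2)).HasTemperateGrowth := by fun_prop
  -- On the Fourier side the equation is `|ξ|² v = 0`; as `v` is a function, it holds almost
  -- everywhere, and `|ξ|²` vanishes only at the origin.
  have h4 : ∀ᵐ x : E3, ((‖x‖ ^ 2 : ℝ) : ℂ) * v x = 0 := by
    apply ae_eq_zero_of_integral_contDiff_smul_eq_zero
    · have := ((Lp.memLp v).locallyIntegrable (by norm_num)).locallyIntegrableOn Set.univ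
      rw [← locallyIntegrableOn_univ]
      exact this.continuousOn_mul (g := fun x : E3 ↦ ((‖x‖ ^ 2 : ℝ) : ℂ))
        (by fun_prop) isClosed_univ.isLocallyClosed
    · intro φ h1φ h2φ
      have hg₁ : HasCompactSupport (Complex.ofRealCLM ∘ φ) := h2φ.comp_left rfl
      have hg₂ : ContDiff ℝ ∞ (Complex.ofRealCLM ∘ φ) := by fun_prop
      have h5 := congrArg (fun T : 𝓢'(E3, ℂ) ↦ T (hg₁.toSchwartzMap hg₂)) h3
      simp only [TemperedDistribution.smulLeftCLM_apply_apply, Lp.toTemperedDistribution_apply,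
        SchwartzMap.smulLeftCLM_apply_apply hg] at h5
      refine Eq.trans (integral_congr_ae (Eventually.of_forall fun x ↦ ?_)) h5
      simp
      ring
  have h6 : v = 0 := by
    rw [Lp.eq_zero_iff_ae_eq_zero]
    have h0 : ∀ᵐ x : E3, x ≠ 0 := by
      simp [ae_iff]
    filter_upwards [h4, h0] with x hx hx0
    simpa [hx0] using hx
  have : ‖u‖ = 0 := by rw [← Lp.norm_fourier_eq, ← hv, h6, norm_zero]
  exact norm_eq_zero.1 this

/-- The standard basis vectors of `ℝ³`. -/
noncomputable abbrev basisVec (i : Fin 3) : E3 := EuclideanSpace.single i 1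

/-- Passes from real to complex test functions by treating real and imaginary parts separately. -/
theorem integral_sum_fderiv_mul_eq_zero {a : Fin 3 → Lp ℂ 2 (volume : Measure E3)}
    (H : ∀ φ : E3 → ℝ, ContDiff ℝ ∞ φ → HasCompactSupport φ →
      ∫ x, ∑ i, (partialDeriv i φ x : ℂ) * a i x = 0)
    {f : E3 → ℂ} (hf : ContDiff ℝ ∞ f) (hc : HasCompactSupport f) :
    ∫ x, ∑ i, fderiv ℝ f x (basisVec i) * a i x = 0 := by
  have hre : ContDiff ℝ ∞ (Complex.reCLM ∘ f) := by fun_prop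
  have him : ContDiff ℝ ∞ (Complex.imCLM ∘ f) := by fun_prop
  have hrec : HasCompactSupport (Complex.reCLM ∘ f) := hc.comp_left rfl
  have himc : HasCompactSupport (Complex.imCLM ∘ f) := hc.comp_left rfl
  have hint : ∀ φ : E3 → ℝ, ContDiff ℝ ∞ φ → HasCompactSupport φ →
      Integrable (fun x ↦ ∑ i, (partialDeriv i φ x : ℂ) * a i x) := by
    intro φ h1 h2
    refine integrable_finsetSum _ fun i _ ↦ MemLp.integrable_mul (p := 2) (q := 2) ?_ (Lp.memLp _)
    refine Continuous.memLp_of_hasCompactSupport ?_ ?_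
    · have : Continuous (fderiv ℝ φ) := h1.continuous_fderiv (by simp)
      unfold partialDeriv
      fun_prop
    · have := (h2.fderiv_apply (𝕜 := ℝ) (basisVec i))
      exact this.comp_left (g := Complex.ofReal) rfl
  have key : ∀ x, ∑ i, fderiv ℝ f x (basisVec i) * a i x =
      (∑ i, (partialDeriv i (Complex.reCLM ∘ f) x : ℂ) * a i x) +
      Complex.I * ∑ i, (partialDeriv i (Complex.imCLM ∘ f) x : ℂ) * a i x := by
    intro x
    have hd : DifferentiableAt ℝ f x := hf.differentiable (by simp) x
    rw [Finset.mul_sum, ← Finset.sum_add_distrib]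
    refine Finset.sum_congr rfl fun i _ ↦ ?_
    have e1 : partialDeriv i (Complex.reCLM ∘ f) x = (fderiv ℝ f x (basisVec i)).re := by
      rw [partialDeriv, fderiv_comp _ (ContinuousLinearMap.differentiableAt _) hd,
        ContinuousLinearMap.fderiv]
      rfl
    have e2 : partialDeriv i (Complex.imCLM ∘ f) x = (fderiv ℝ f x (basisVec i)).im := by
      rw [partialDeriv, fderiv_comp _ (ContinuousLinearMap.differentiableAt _) hd,
        ContinuousLinearMap.fderiv]
      rfl
    rw [e1, e2]
    conv_lhs => rw [← Complex.re_add_im (fderiv ℝ f x (basisVec i))]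
    ring
  simp_rw [key]
  rw [integral_add (hint _ hre hrec) ((hint _ him himc).const_mul _), integral_const_mul,
    H _ hre hrec, H _ him himc]
  simp

/-- A first-order equation satisfied by an `L²` field in the sense of distributions holds in the
sense of tempered distributions. -/
theorem sum_lineDeriv_eq_zero {a : Fin 3 → Lp ℂ 2 (volume : Measure E3)}
    (H : ∀ φ : E3 → ℝ, ContDiff ℝ ∞ φ → HasCompactSupport φ →
      ∫ x, ∑ i, (partialDeriv i φ x : ℂ) * a i x = 0) :
    ∑ i, ∂_{basisVec i} (a i : 𝓢'(E3, ℂ)) = 0 := by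
  ext f
  let b : ContDiffBump (0 : E3) := ⟨1, 2, one_pos, one_lt_two⟩
  have hb : ContDiff ℝ ∞ b := b.contDiff
  have hbc : HasCompactSupport b := b.hasCompactSupport
  obtain ⟨C, hC⟩ : ∃ C, ∀ x, ‖fderiv ℝ b x‖ ≤ C :=
    (hb.continuous_fderiv (by simp)).bounded_above_of_compact_support (hbc.fderiv (𝕜 := ℝ))
  have hC0 : 0 ≤ C := (norm_nonneg _).trans (hC 0)
  let c : ℕ → ℝ := fun n ↦ ((n : ℝ) + 1)⁻¹
  have hc0 : ∀ n, c n ≠ 0 := fun n ↦ by positivity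
  have hcn : ∀ n, 0 ≤ c n := fun n ↦ by positivity
  have hc1 : ∀ n, c n ≤ 1 := fun n ↦ inv_le_one_of_one_le₀ (by simp)
  have hct : Tendsto c atTop (𝓝 0) := by
    simpa [c] using tendsto_one_div_add_atTop_nhds_zero_nat (𝕜 := ℝ)
  -- A Schwartz function `f` is approximated by `χ n • f` with `χ n (x) = b (x / (n + 1))`. The
  -- terms containing the derivative of the cutoff carry the factor `c n` and disappear in the
  -- limit, by dominated convergence.
  let χ : ℕ → E3 → ℝ := fun n x ↦ b (c n • x)
  have hχ : ∀ n, ContDiff ℝ ∞ (χ n) := fun n ↦ hb.comp (contDiff_const_smul _)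
  have hχc : ∀ n, HasCompactSupport (χ n) := fun n ↦ hbc.comp_smul (hc0 n)
  have hχd : ∀ n x v, fderiv ℝ (χ n) x v = c n * fderiv ℝ b (c n • x) v := by
    intro n x v
    have h1 : HasFDerivAt b (fderiv ℝ b (c n • x)) (c n • x) :=
      (hb.differentiable (by simp) _).hasFDerivAt
    have h2 : HasFDerivAt (fun x : E3 ↦ c n • x) (c n • ContinuousLinearMap.id ℝ E3) x :=
      (hasFDerivAt_id x).fun_const_smul _
    have := (h1.comp x h2).fderiv
    change fderiv ℝ (fun x : E3 ↦ b (c n • x)) x = _ at this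
    simp [χ, this]
  have hfd : ContDiff ℝ ∞ f := f.smooth _
  let F : ℕ → E3 → ℂ := fun n x ↦
    ∑ i, ((χ n x : ℂ) * fderiv ℝ f x (basisVec i)
      + (c n * fderiv ℝ b (c n • x) (basisVec i) : ℝ) * f x) * a i x
  have hF0 : ∀ n, ∫ x, F n x = 0 := by
    intro n
    have hsm : ContDiff ℝ ∞ (fun x ↦ χ n x • f x) := (hχ n).smul hfd
    rw [← integral_sum_fderiv_mul_eq_zero H hsm (hχc n).smul_right]
    refine integral_congr_ae (Eventually.of_forall fun x ↦ Finset.sum_congr rfl fun i _ ↦ ?_)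
    have h1 := ((hχ n).differentiable (by simp) x).hasFDerivAt
    have h2 := (hfd.differentiable (by simp) x).hasFDerivAt
    rw [(h1.fun_smul h2).fderiv]
    simp [hχd]
  have hmem : ∀ i, MemLp (fun x ↦ fderiv ℝ f x (basisVec i)) 2 := by
    intro i
    have := (∂_{basisVec i} f).memLp 2 (volume : Measure E3)
    refine this.congr_norm ?_ ?_
    · have : Continuous (fderiv ℝ f) := hfd.continuous_fderiv (by simp)
      exact (by fun_prop : Continuous fun x ↦ fderiv ℝ f x (basisVec i)).aestronglyMeasurable
    · exact Eventually.of_forall fun x ↦ by rw [SchwartzMap.lineDerivOp_apply_eq_fderiv]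
  have hlim : Tendsto (fun n ↦ ∫ x, F n x) atTop
      (𝓝 (∫ x, ∑ i, fderiv ℝ f x (basisVec i) * a i x)) := by
    refine tendsto_integral_of_dominated_convergence
      (fun x ↦ ∑ i, (‖fderiv ℝ f x (basisVec i)‖ + C * ‖f x‖) * ‖a i x‖) ?_ ?_ ?_ ?_
    · intro n
      refine Finset.aestronglyMeasurable_fun_sum _ fun i _ ↦ ?_
      refine AEStronglyMeasurable.mul (Continuous.aestronglyMeasurable ?_)
        (Lp.aestronglyMeasurable _)
      have k1 : Continuous (fderiv ℝ f) := hfd.continuous_fderiv (by simp)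
      have k2 : Continuous (fderiv ℝ b) := hb.continuous_fderiv (by simp)
      have k3 : Continuous (χ n) := (hχ n).continuous
      have k4 : Continuous f := hfd.continuous
      fun_prop
    · refine integrable_finsetSum _ fun i _ ↦ MemLp.integrable_mul (p := 2) (q := 2) ?_
        (Lp.memLp _).norm
      exact (hmem i).norm.add ((f.memLp 2 (volume : Measure E3)).norm.const_mul C)
    · intro n
      refine Eventually.of_forall fun x ↦ ?_
      refine (norm_sum_le _ _).trans (Finset.sum_le_sum fun i _ ↦ ?_)
      rw [norm_mul]
      gcongr
      refine (norm_add_le _ _).trans ?_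
      rw [norm_mul, norm_mul]
      gcongr
      · refine mul_le_of_le_one_left (norm_nonneg _) ?_
        rw [Complex.norm_real, Real.norm_of_nonneg b.nonneg]
        exact b.le_one
      · rw [Complex.norm_real, norm_mul, Real.norm_of_nonneg (hcn n)]
        refine (mul_le_of_le_one_left (norm_nonneg _) (hc1 n)).trans ?_
        refine ((fderiv ℝ b (c n • x)).le_opNorm _).trans ?_
        simpa using hC (c n • x)
    · refine Eventually.of_forall fun x ↦ tendsto_finsetSum _ fun i _ ↦ ?_
      refine Tendsto.mul_const _ ?_
      have t1 : Tendsto (fun n ↦ χ n x) atTop (𝓝 1) := by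
        have : Tendsto (fun n ↦ c n • x) atTop (𝓝 0) := by simpa using hct.smul_const x
        have := (hb.continuous.tendsto 0).comp this
        rwa [b.one_of_mem_closedBall (by simp [b.rIn_pos.le])] at this
      have t2 : Tendsto (fun n ↦ c n * fderiv ℝ b (c n • x) (basisVec i)) atTop (𝓝 0) := by
        refine squeeze_zero_norm (a := fun n ↦ c n * C) (fun n ↦ ?_)
          (by simpa using hct.mul_const C)
        rw [norm_mul, Real.norm_of_nonneg (hcn n)]
        gcongr
        refine ((fderiv ℝ b (c n • x)).le_opNorm _).trans ?_
        simpa using hC (c n • x)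
      have t1' := (Complex.continuous_ofReal.tendsto 1).comp t1
      have t2' := (Complex.continuous_ofReal.tendsto 0).comp t2
      simpa using (t1'.mul_const (fderiv ℝ f x (basisVec i))).add (t2'.mul_const (f x))
  simp only [hF0] at hlim
  have hz := tendsto_nhds_unique tendsto_const_nhds hlim
  simp only [TemperedDistribution.lineDerivOp_apply_apply, sum_apply,
    Lp.toTemperedDistribution_apply]
  rw [← integral_finsetSum]
  · change _ = (0 : ℂ)
    rw [← neg_zero, hz, ← integral_neg]
    refine integral_congr_ae (Eventually.of_forall fun x ↦ ?_)
    simp [SchwartzMap.lineDerivOp_apply_eq_fderiv]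
  · intro i _
    exact MemLp.integrable_mul (p := 2) (q := 2) ((-∂_{basisVec i} f).memLp 2 _) (Lp.memLp _)

theorem fderiv_fderiv_comm {F : Type*} [NormedAddCommGroup F] [NormedSpace ℝ F] {f : E3 → F}
    (hf : ContDiff ℝ ∞ f) (x u v : E3) :
    fderiv ℝ (fun y ↦ fderiv ℝ f y u) x v = fderiv ℝ (fun y ↦ fderiv ℝ f y v) x u := by
  have hd : DifferentiableAt ℝ (fderiv ℝ f) x :=
    (hf.fderiv_right (m := ∞) (by simp)).differentiable (by simp) x
  have h : ∀ w, fderiv ℝ (fun y ↦ fderiv ℝ f y w) x = (fderiv ℝ (fderiv ℝ f) x).flip w := by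
    intro w
    ext z
    rw [fderiv_clm_apply hd (differentiableAt_const w)]
    simp
  rw [h, h]
  refine (hf.contDiffAt.isSymmSndFDerivAt ?_) v u
  simpa using (mod_cast le_top : ((2 : ℕ∞) : ℕ∞ω) ≤ ((⊤ : ℕ∞) : ℕ∞ω))

theorem lineDeriv_comm (u v : E3) (T : 𝓢'(E3, ℂ)) : ∂_{u} (∂_{v} T) = ∂_{v} (∂_{u} T) := by
  ext f
  have h : ∂_{v} (∂_{u} f) = ∂_{u} (∂_{v} f) := by
    ext x
    have e : ∀ w, ((∂_{w} f : 𝓢(E3, ℂ)) : E3 → ℂ) = fun y ↦ fderiv ℝ f y w := fun w ↦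
      funext fun y ↦ SchwartzMap.lineDerivOp_apply_eq_fderiv ..
    rw [SchwartzMap.lineDerivOp_apply_eq_fderiv, SchwartzMap.lineDerivOp_apply_eq_fderiv, e, e]
    exact fderiv_fderiv_comm (f.smooth _) x u v
  simp only [TemperedDistribution.lineDerivOp_apply_apply, lineDerivOp_neg, h]

/-- The `i`-th component of an `L²` field, as a complex-valued function. -/
noncomputable def component (i : Fin 3) (h : Lp E3 2 (volume : Measure E3)) :
    Lp ℂ 2 (volume : Measure E3) :=
  (Complex.ofRealCLM ∘L EuclideanSpace.proj (𝕜 := ℝ) i).compLp h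

theorem coeFn_component (i : Fin 3) (h : Lp E3 2 (volume : Measure E3)) :
    ∀ᵐ x, component i h x = (h x i : ℂ) :=
  (Complex.ofRealCLM ∘L EuclideanSpace.proj (𝕜 := ℝ) i).coeFn_compLp h

/-- The distributional partial derivative of an `L²` function. -/
noncomputable def weakDeriv (i : Fin 3) : Lp ℂ 2 (volume : Measure E3) →L[ℂ] 𝓢'(E3, ℂ) :=
  lineDerivOpCLM ℂ 𝓢'(E3, ℂ) (basisVec i) ∘L Lp.toTemperedDistributionCLM ℂ volume 2

/-- An `L²` field which is divergence-free and curl-free in the sense of distributions is zero. -/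
theorem eq_zero_of_div_curl_eq_zero {h : Lp E3 2 (volume : Measure E3)}
    (hdiv : ∀ φ : E3 → ℝ, ContDiff ℝ ∞ φ → HasCompactSupport φ →
      ∫ x, ∑ i : Fin 3, h x i * partialDeriv i φ x = 0)
    (hcurl : ∀ φ : E3 → ℝ, ContDiff ℝ ∞ φ → HasCompactSupport φ → ∀ i j : Fin 3,
      ∫ x, (h x i * partialDeriv j φ x - h x j * partialDeriv i φ x) = 0) : h = 0 := by
  have hall : ∀ᵐ x, ∀ i, component i h x = (h x i : ℂ) := ae_all_iff.2 fun i ↦ coeFn_component i h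
  have D : ∑ i, ∂_{basisVec i} (component i h : 𝓢'(E3, ℂ)) = 0 := by
    refine sum_lineDeriv_eq_zero fun φ h1 h2 ↦ ?_
    have := congrArg (fun r : ℝ ↦ (r : ℂ)) (hdiv φ h1 h2)
    rw [← integral_complex_ofReal, Complex.ofReal_zero] at this
    rw [← this]
    refine integral_congr_ae ?_
    filter_upwards [hall] with x hx
    simp [hx, mul_comm]
  have C : ∀ i j, ∂_{basisVec j} (component i h : 𝓢'(E3, ℂ)) =
      ∂_{basisVec i} (component j h : 𝓢'(E3, ℂ)) := by
    intro i j
    -- The curl equation is the divergence equation of the field with `hᵢ` in slot `j` and `-hⱼ` in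
    -- slot `i`; writing it as a difference also covers `i = j`.
    have key := sum_lineDeriv_eq_zero (a := Pi.single j (component i h) - Pi.single i (component j h))
      fun φ h1 h2 ↦ ?_
    · have s : ∀ k (u : Lp ℂ 2 (volume : Measure E3)),
          ∑ l, weakDeriv l ((Pi.single k u : Fin 3 → Lp ℂ 2 (volume : Measure E3)) l) =
            weakDeriv k u := by
        intro k u
        rw [Finset.sum_eq_single k (fun l _ hl ↦ by rw [Pi.single_eq_of_ne hl, map_zero]) (by simp),
          Pi.single_eq_same]
      have key' : ∑ l, weakDeriv l ((Pi.single j (component i h) - Pi.single i (component j h) :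
          Fin 3 → Lp ℂ 2 (volume : Measure E3)) l) = 0 := key
      simp only [Pi.sub_apply, map_sub, Finset.sum_sub_distrib, s] at key'
      exact sub_eq_zero.1 key'
    · have := congrArg (fun r : ℝ ↦ (r : ℂ)) (hcurl φ h1 h2 i j)
      rw [← integral_complex_ofReal, Complex.ofReal_zero] at this
      rw [← this]
      refine integral_congr_ae ?_
      have hz : ∀ᵐ x, ∀ k, ((Pi.single j (component i h) - Pi.single i (component j h) :
          Fin 3 → Lp ℂ 2 (volume : Measure E3)) k) x =
          (if k = j then (h x i : ℂ) else 0) - (if k = i then (h x j : ℂ) else 0) := by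
        refine ae_all_iff.2 fun k ↦ ?_
        rw [Pi.sub_apply]
        filter_upwards [hall, Lp.coeFn_sub ((Pi.single j (component i h) :
          Fin 3 → Lp ℂ 2 (volume : Measure E3)) k) ((Pi.single i (component j h) :
          Fin 3 → Lp ℂ 2 (volume : Measure E3)) k)] with x hx hs
        rw [hs, Pi.sub_apply, Pi.single_apply, Pi.single_apply]
        split_ifs <;> simp [hx]
      filter_upwards [hz] with x hx
      simp only [hx]
      simp [mul_sub, Finset.sum_sub_distrib, mul_comm]
  have L : ∀ i, component i h = 0 := by
    intro i
    apply eq_zero_of_laplacian_eq_zero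
    rw [TemperedDistribution.laplacian_eq_sum (EuclideanSpace.basisFun (Fin 3) ℝ)]
    simp only [EuclideanSpace.basisFun_apply]
    -- Since `∂ₖ hᵢ = ∂ᵢ hₖ`, the Laplacian of `hᵢ` is `∂ᵢ (div h)`.
    calc ∑ k, ∂_{basisVec k} (∂_{basisVec k} (component i h : 𝓢'(E3, ℂ)))
        = ∑ k, ∂_{basisVec i} (∂_{basisVec k} (component k h : 𝓢'(E3, ℂ))) :=
          Finset.sum_congr rfl fun k _ ↦ by rw [C i k, lineDeriv_comm]
      _ = ∂_{basisVec i} (∑ k, ∂_{basisVec k} (component k h : 𝓢'(E3, ℂ))) :=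
          (lineDerivOp_sum (basisVec i) _ _).symm
      _ = 0 := by rw [D, lineDerivOp_zero]
  rw [Lp.eq_zero_iff_ae_eq_zero]
  filter_upwards [hall, Lp.coeFn_zero ℂ 2 (volume : Measure E3)] with x hx h0
  ext i
  have := hx i
  rw [L i, h0] at this
  simpa using this.symm

/-! ### The stray field as an orthogonal projection -/

/-- Mixed second derivatives commute in the weak sense, for a Lipschitz function. -/
theorem integral_lineDeriv_mul_partialDeriv_comm {C : NNReal} {G : E3 → ℝ} (hG : LipschitzWith C G)
    {φ : E3 → ℝ} (hφ : ContDiff ℝ ∞ φ) (hc : HasCompactSupport φ) (i j : Fin 3) :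
    ∫ x, lineDeriv ℝ G x (basisVec i) * partialDeriv j φ x =
      ∫ x, lineDeriv ℝ G x (basisVec j) * partialDeriv i φ x := by
  have hs : ∀ k, ContDiff ℝ ∞ (partialDeriv k φ) := fun k ↦
    (hφ.fderiv_right (m := ∞) (by simp)).clm_apply contDiff_const
  have hcs : ∀ k, HasCompactSupport (partialDeriv k φ) := fun k ↦ hc.fderiv_apply (𝕜 := ℝ) _
  have hl : ∀ k, ∃ D, LipschitzWith D (partialDeriv k φ) := fun k ↦
    (hs k).lipschitzWith_of_hasCompactSupport (hcs k) (by simp)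
  obtain ⟨D1, hD1⟩ := hl i
  obtain ⟨D2, hD2⟩ := hl j
  -- Integration by parts moves the derivative from `G` to `φ`, where second derivatives commute
  -- classically.
  rw [hG.integral_lineDeriv_mul_eq hD2 (hcs j), hG.integral_lineDeriv_mul_eq hD1 (hcs i)]
  refine integral_congr_ae (Eventually.of_forall fun x ↦ ?_)
  dsimp only
  rw [((hs i).differentiable (by simp) x).lineDeriv_eq_fderiv,
    ((hs j).differentiable (by simp) x).lineDeriv_eq_fderiv]
  simp only [map_neg]
  congr 2
  exact fderiv_fderiv_comm hφ x (basisVec j) (basisVec i)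

/-- The gradient of a scalar function. -/
noncomputable def gradField (φ : E3 → ℝ) (x : E3) : E3 :=
  WithLp.toLp 2 fun i ↦ partialDeriv i φ x

/-- The field `∂ⱼ φ eᵢ - ∂ᵢ φ eⱼ`. -/
noncomputable def curlField (i j : Fin 3) (φ : E3 → ℝ) (x : E3) : E3 :=
  partialDeriv j φ x • basisVec i - partialDeriv i φ x • basisVec j

theorem continuous_partialDeriv {φ : E3 → ℝ} (hφ : ContDiff ℝ ∞ φ) (i : Fin 3) :
    Continuous (partialDeriv i φ) :=
  (hφ.continuous_fderiv (by simp)).clm_apply continuous_const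

theorem memLp_partialDeriv {φ : E3 → ℝ} (hφ : ContDiff ℝ ∞ φ) (hc : HasCompactSupport φ)
    (i : Fin 3) : MemLp (partialDeriv i φ) 2 (volume : Measure E3) :=
  (continuous_partialDeriv hφ i).memLp_of_hasCompactSupport (hc.fderiv_apply (𝕜 := ℝ) _)

theorem memLp_curlField {φ : E3 → ℝ} (hφ : ContDiff ℝ ∞ φ) (hc : HasCompactSupport φ)
    (i j : Fin 3) : MemLp (curlField i j φ) 2 (volume : Measure E3) := by
  have h : ∀ k l : Fin 3, MemLp (fun x ↦ partialDeriv k φ x • basisVec l) 2 volume := fun k l ↦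
    ((ContinuousLinearMap.id ℝ ℝ).smulRight (basisVec l)).comp_memLp' (memLp_partialDeriv hφ hc k)
  exact (h j i).sub (h i j)

theorem memLp_gradField {φ : E3 → ℝ} (hφ : ContDiff ℝ ∞ φ) (hc : HasCompactSupport φ) :
    MemLp (gradField φ) 2 (volume : Measure E3) := by
  have h : ∀ k : Fin 3, MemLp (fun x ↦ partialDeriv k φ x • basisVec k) 2 volume := fun k ↦
    ((ContinuousLinearMap.id ℝ ℝ).smulRight (basisVec k)).comp_memLp' (memLp_partialDeriv hφ hc k)
  refine (memLp_finsetSum Finset.univ fun k _ ↦ h k).ae_eq (Eventually.of_forall fun x ↦ ?_)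
  ext i
  simp [gradField, Finset.sum_apply, Pi.single_apply]

theorem inner_gradField (φ : E3 → ℝ) (x v : E3) :
    inner ℝ (gradField φ x) v = ∑ i, v i * partialDeriv i φ x := by
  simp [gradField, PiLp.inner_apply]

theorem inner_curlField (i j : Fin 3) (φ : E3 → ℝ) (x v : E3) :
    inner ℝ (curlField i j φ x) v = v i * partialDeriv j φ x - v j * partialDeriv i φ x := by
  simp [curlField, inner_sub_left, inner_smul_left, EuclideanSpace.inner_single_left, mul_comm]

/-- The gradients of test functions, in `L²(ℝ³; ℝ³)`. -/
def gradients : Set (Lp E3 2 (volume : Measure E3)) :=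
  {g | ∃ φ : E3 → ℝ, ContDiff ℝ ∞ φ ∧ HasCompactSupport φ ∧ g =ᵐ[volume] gradField φ}

/-- The fields `∂ⱼ φ eᵢ - ∂ᵢ φ eⱼ` of test functions, in `L²(ℝ³; ℝ³)`. -/
def curls : Set (Lp E3 2 (volume : Measure E3)) :=
  {g | ∃ φ : E3 → ℝ, ContDiff ℝ ∞ φ ∧ HasCompactSupport φ ∧
    ∃ i j, g =ᵐ[volume] curlField i j φ}

/-- The representative `w` is left free so that explicit functions such as `Ω.indicator m + h` can
be inserted. -/
theorem forall_gradients_inner_eq_zero_iff {v : Lp E3 2 (volume : Measure E3)} {w : E3 → E3}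
    (hw : v =ᵐ[volume] w) :
    (∀ g ∈ gradients, inner ℝ g v = 0) ↔
      ∀ φ : E3 → ℝ, ContDiff ℝ ∞ φ → HasCompactSupport φ →
        ∫ x, ∑ i : Fin 3, w x i * partialDeriv i φ x = 0 := by
  have key : ∀ (g : Lp E3 2 (volume : Measure E3)) φ, g =ᵐ[volume] gradField φ →
      inner ℝ g v = ∫ x, ∑ i : Fin 3, w x i * partialDeriv i φ x := by
    intro g φ hg
    rw [L2.inner_def]
    refine integral_congr_ae ?_
    filter_upwards [hg, hw] with x h1 h2
    rw [h1, h2, inner_gradField]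
  constructor
  · intro H φ h1 h2
    have hg := (memLp_gradField h1 h2).coeFn_toLp
    rw [← key _ φ hg]
    exact H _ ⟨φ, h1, h2, hg⟩
  · rintro H g ⟨φ, h1, h2, hg⟩
    rw [key g φ hg, H φ h1 h2]

theorem forall_curls_inner_eq_zero_iff {v : Lp E3 2 (volume : Measure E3)} {w : E3 → E3}
    (hw : v =ᵐ[volume] w) :
    (∀ g ∈ curls, inner ℝ g v = 0) ↔
      ∀ φ : E3 → ℝ, ContDiff ℝ ∞ φ → HasCompactSupport φ → ∀ i j : Fin 3,
        ∫ x, (w x i * partialDeriv j φ x - w x j * partialDeriv i φ x) = 0 := by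
  have key : ∀ (g : Lp E3 2 (volume : Measure E3)) i j φ, g =ᵐ[volume] curlField i j φ →
      inner ℝ g v = ∫ x, (w x i * partialDeriv j φ x - w x j * partialDeriv i φ x) := by
    intro g i j φ hg
    rw [L2.inner_def]
    refine integral_congr_ae ?_
    filter_upwards [hg, hw] with x h1 h2
    rw [h1, h2, inner_curlField]
  constructor
  · intro H φ h1 h2 i j
    have hg := (memLp_curlField h1 h2 i j).coeFn_toLp
    rw [← key _ i j φ hg]
    exact H _ ⟨φ, h1, h2, i, j, hg⟩
  · rintro H g ⟨φ, h1, h2, i, j, hg⟩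
    rw [key g i j φ hg, H φ h1 h2]

theorem eq_zero_of_inner_eq_zero {v : Lp E3 2 (volume : Measure E3)}
    (h1 : ∀ g ∈ gradients, inner ℝ g v = 0) (h2 : ∀ g ∈ curls, inner ℝ g v = 0) : v = 0 :=
  eq_zero_of_div_curl_eq_zero
    ((forall_gradients_inner_eq_zero_iff (ae_eq_refl _)).1 h1)
    ((forall_curls_inner_eq_zero_iff (ae_eq_refl _)).1 h2)

/-- This is `curl ∇ψ = 0` in weak form. -/
theorem inner_curls_gradients {c g : Lp E3 2 (volume : Measure E3)} (hc : c ∈ curls)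
    (hg : g ∈ gradients) : inner ℝ c g = 0 := by
  obtain ⟨ψ, h1, h2, hψ⟩ := hg
  refine (forall_curls_inner_eq_zero_iff hψ).2 (fun φ h3 h4 i j ↦ ?_) c hc
  obtain ⟨C, hC⟩ := h1.lipschitzWith_of_hasCompactSupport h2 (by simp)
  have := integral_lineDeriv_mul_partialDeriv_comm hC h3 h4 i j
  have e : ∀ k x, lineDeriv ℝ ψ x (basisVec k) = partialDeriv k ψ x := fun k x ↦
    (h1.differentiable (by simp) x).lineDeriv_eq_fderiv
  simp only [e] at this
  simp only [gradField]
  rw [integral_sub, this, sub_self]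
  · exact (memLp_partialDeriv h1 h2 i).integrable_mul (memLp_partialDeriv h3 h4 j)
  · exact (memLp_partialDeriv h1 h2 j).integrable_mul (memLp_partialDeriv h3 h4 i)

/-- The closure in `L²(ℝ³; ℝ³)` of the gradients of test functions. -/
noncomputable def gradientSpace : Submodule ℝ (Lp E3 2 (volume : Measure E3)) :=
  (Submodule.span ℝ gradients).topologicalClosure

instance : CompleteSpace gradientSpace :=
  (Submodule.isClosed_topologicalClosure _).completeSpace_coe

theorem mem_gradientSpace {g : Lp E3 2 (volume : Measure E3)} (hg : g ∈ gradients) :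
    g ∈ gradientSpace :=
  Submodule.le_topologicalClosure _ (Submodule.subset_span hg)

theorem inner_curls_gradientSpace {c g : Lp E3 2 (volume : Measure E3)} (hc : c ∈ curls)
    (hg : g ∈ gradientSpace) : inner ℝ c g = 0 := by
  have : gradientSpace ≤ (ℝ ∙ c)ᗮ := by
    refine Submodule.topologicalClosure_minimal _ ?_ (Submodule.isClosed_orthogonal _)
    rw [Submodule.span_le]
    exact fun g hg ↦ Submodule.mem_orthogonal_singleton_iff_inner_right.2
      (inner_curls_gradients hc hg)
  exact Submodule.mem_orthogonal_singleton_iff_inner_right.1 (this hg)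

/-- The extension by zero `L²(Ω; ℝ³) → L²(ℝ³; ℝ³)`. -/
noncomputable def extendZero {Ω : Set E3} (hΩ : MeasurableSet Ω) (m : L2 Ω) :
    Lp E3 2 (volume : Measure E3) :=
  ((memLp_indicator_iff_restrict hΩ).2 (Lp.memLp m)).toLp _

theorem coeFn_extendZero {Ω : Set E3} (hΩ : MeasurableSet Ω) (m : L2 Ω) :
    extendZero hΩ m =ᵐ[volume] Ω.indicator m :=
  MemLp.coeFn_toLp _

theorem isStrayField_iff {Ω : Set E3} (hΩ : MeasurableSet Ω) (m : L2 Ω)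
    (h : Lp E3 2 (volume : Measure E3)) :
    IsStrayField Ω m h ↔ (∀ g ∈ gradients, inner ℝ g (extendZero hΩ m + h) = 0) ∧
      ∀ g ∈ curls, inner ℝ g h = 0 := by
  have e : ↑(extendZero hΩ m + h) =ᵐ[volume] fun x ↦ Ω.indicator m x + h x := by
    filter_upwards [Lp.coeFn_add (extendZero hΩ m) h, coeFn_extendZero hΩ m] with x h1 h2
    rw [h1, Pi.add_apply, h2]
  rw [forall_gradients_inner_eq_zero_iff e, forall_curls_inner_eq_zero_iff (ae_eq_refl _)]
  exact ⟨fun H ↦ ⟨H.1, H.2⟩, fun H ↦ ⟨H.1, H.2⟩⟩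

/-- The residual `m χ - P (m χ)` is orthogonal to gradients, which is the divergence equation; the
range of `P` is orthogonal to curls, which is the curl equation. -/
theorem isStrayField_neg_starProjection {Ω : Set E3} (hΩ : MeasurableSet Ω) (m : L2 Ω) :
    IsStrayField Ω m (-gradientSpace.starProjection (extendZero hΩ m)) := by
  rw [isStrayField_iff hΩ]
  refine ⟨fun g hg ↦ ?_, fun g hg ↦ ?_⟩
  · rw [← sub_eq_add_neg]
    exact Submodule.inner_right_of_mem_orthogonal (mem_gradientSpace hg)
      (Submodule.sub_starProjection_mem_orthogonal _)
  · rw [inner_neg_right, inner_curls_gradientSpace hg (Submodule.starProjection_apply_mem _ _),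
      neg_zero]

theorem IsStrayField.unique {Ω : Set E3} (hΩ : MeasurableSet Ω) {m : L2 Ω}
    {h h' : Lp E3 2 (volume : Measure E3)} (H : IsStrayField Ω m h) (H' : IsStrayField Ω m h') :
    h = h' := by
  rw [isStrayField_iff hΩ] at H H'
  refine sub_eq_zero.1 (eq_zero_of_inner_eq_zero (fun g hg ↦ ?_) fun g hg ↦ ?_)
  · have := H.1 g hg
    have := H'.1 g hg
    simp only [inner_add_right, inner_sub_right] at *
    linarith
  · rw [inner_sub_right, H.2 g hg, H'.2 g hg, sub_zero]

/-- Existence makes the `epsilon` choice a genuine solution, and uniqueness identifies it with the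
projection. -/
theorem strayField_eq {Ω : Set E3} (hΩ : MeasurableSet Ω) (m : L2 Ω) :
    strayField Ω m = -gradientSpace.starProjection (extendZero hΩ m) :=
  (Classical.epsilon_spec (p := IsStrayField Ω m) ⟨_, isStrayField_neg_starProjection hΩ m⟩).unique
    hΩ (isStrayField_neg_starProjection hΩ m)

/-! ### The explicit stray field of a uniformly magnetized ball -/

theorem abs_mul_sub_mul_le {f g : E3 → ℝ} {A B C D : ℝ}
    (hf : ∀ x, |f x| ≤ A) (hg : ∀ x, |g x| ≤ B)
    (hf' : ∀ x y, |f x - f y| ≤ C * ‖x - y‖) (hg' : ∀ x y, |g x - g y| ≤ D * ‖x - y‖) (x y : E3) :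
    |f x * g x - f y * g y| ≤ (A * D + B * C) * ‖x - y‖ := by
  have e : f x * g x - f y * g y = f x * (g x - g y) + g y * (f x - f y) := by ring
  have hA : 0 ≤ A := (abs_nonneg _).trans (hf x)
  have hB : 0 ≤ B := (abs_nonneg _).trans (hg x)
  rw [e]
  refine (abs_add_le _ _).trans ?_
  rw [abs_mul, abs_mul]
  calc |f x| * |g x - g y| + |g y| * |f x - f y|
      ≤ A * (D * ‖x - y‖) + B * (C * ‖x - y‖) := by
        gcongr
        exacts [hf x, hg' x y, hg y, hf' x y]
    _ = _ := by ring

/-- The components of the field equal to `x / 3` in the ball of radius `R` and to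
`R³ x / (3 |x|³)` outside; it is minus the gradient of the Newtonian potential of the ball. -/
noncomputable def ballField (R : ℝ) (k : Fin 3) (x : E3) : ℝ :=
  R ^ 3 / 3 * (((max ‖x‖ R)⁻¹ * (max ‖x‖ R)⁻¹) * ((max ‖x‖ R)⁻¹ * x k))

/-- With `u = 1 / max ‖x‖ R`, the field is a multiple of `(u * u) * (u * x k)`, and `u` and `u * x
k` are both bounded and Lipschitz. The Lipschitz property is what permits integration by parts
across the sphere without boundary terms. -/
theorem exists_lipschitzWith_ballField {R : ℝ} (hR : 0 < R) (k : Fin 3) :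
    ∃ C, LipschitzWith C (ballField R k) := by
  have hpos : ∀ x : E3, 0 < max ‖x‖ R := fun x ↦ lt_max_of_lt_right hR
  have hmax : ∀ x y : E3, |max ‖x‖ R - max ‖y‖ R| ≤ ‖x - y‖ := fun x y ↦
    (abs_max_sub_max_le_abs _ _ _).trans (abs_norm_sub_norm_le x y)
  have hub : ∀ x : E3, |(max ‖x‖ R)⁻¹| ≤ R⁻¹ := fun x ↦ by
    rw [abs_of_pos (inv_pos.2 (hpos x))]
    exact inv_anti₀ hR (le_max_right _ _)
  have hdiff : ∀ x y : E3, (max ‖x‖ R)⁻¹ - (max ‖y‖ R)⁻¹ =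
      (max ‖x‖ R)⁻¹ * (max ‖y‖ R)⁻¹ * (max ‖y‖ R - max ‖x‖ R) := fun x y ↦ by
    have := (hpos x).ne'
    have := (hpos y).ne'
    field_simp
  have hul : ∀ x y : E3, |(max ‖x‖ R)⁻¹ - (max ‖y‖ R)⁻¹| ≤ R⁻¹ * R⁻¹ * ‖x - y‖ := fun x y ↦ by
    rw [hdiff, abs_mul, abs_mul, norm_sub_rev]
    gcongr
    exacts [hub x, hub y, hmax y x]
  have hcoord : ∀ x : E3, |x k| ≤ ‖x‖ := fun x ↦ PiLp.norm_apply_le x k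
  have hvb : ∀ x : E3, |(max ‖x‖ R)⁻¹ * x k| ≤ 1 := fun x ↦ by
    rw [abs_mul, abs_of_pos (inv_pos.2 (hpos x)), inv_mul_le_iff₀ (hpos x), mul_one]
    exact (hcoord x).trans (le_max_left _ _)
  have hvl : ∀ x y : E3, |(max ‖x‖ R)⁻¹ * x k - (max ‖y‖ R)⁻¹ * y k| ≤ (2 * R⁻¹) * ‖x - y‖ := by
    intro x y
    have e : (max ‖x‖ R)⁻¹ * x k - (max ‖y‖ R)⁻¹ * y k = (max ‖x‖ R)⁻¹ * (x - y) k +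
        (max ‖x‖ R)⁻¹ * ((max ‖y‖ R - max ‖x‖ R) * ((max ‖y‖ R)⁻¹ * y k)) := by
      have h := hdiff x y
      rw [PiLp.sub_apply]
      linear_combination (y k) * h
    rw [e]
    refine (abs_add_le _ _).trans ?_
    rw [abs_mul, abs_mul, abs_mul (max ‖y‖ R - max ‖x‖ R)]
    calc _ ≤ R⁻¹ * ‖x - y‖ + R⁻¹ * (‖y - x‖ * 1) := by
          gcongr
          exacts [hub x, hcoord _, hub x, hmax y x, hvb y]
      _ = _ := by rw [norm_sub_rev y x]; ring
  have h2b : ∀ x : E3, |(max ‖x‖ R)⁻¹ * (max ‖x‖ R)⁻¹| ≤ R⁻¹ * R⁻¹ := fun x ↦ by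
    rw [abs_mul]
    gcongr
    exacts [hub x, hub x]
  have h2l := abs_mul_sub_mul_le hub hub hul hul
  have h3l := abs_mul_sub_mul_le h2b hvb h2l hvl
  have key : ∀ x y, dist (ballField R k x) (ballField R k y) ≤ R ^ 3 / 3 *
      (R⁻¹ * R⁻¹ * (2 * R⁻¹) + 1 * (R⁻¹ * (R⁻¹ * R⁻¹) + R⁻¹ * (R⁻¹ * R⁻¹))) * dist x y := by
    intro x y
    rw [Real.dist_eq, dist_eq_norm, ballField, ballField, ← mul_sub, abs_mul,
      abs_of_pos (by positivity)]
    exact (mul_le_mul_of_nonneg_left (h3l x y) (by positivity)).trans_eq (mul_assoc _ _ _).symm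
  exact ⟨_, LipschitzWith.of_dist_le' key⟩

/-- The partial derivatives `∂ᵢ` of the components of `ballField`. -/
noncomputable def ballFieldDeriv (R : ℝ) (k i : Fin 3) (x : E3) : ℝ :=
  if ‖x‖ < R then (if k = i then 1 / 3 else 0) else
    R ^ 3 / 3 * (‖x‖⁻¹ ^ 3 * (if k = i then 1 else 0) - 3 * ‖x‖⁻¹ ^ 5 * (x k * x i))

theorem ballFieldDeriv_comm (R : ℝ) (k i : Fin 3) : ballFieldDeriv R k i = ballFieldDeriv R i k := by
  funext x
  simp only [ballFieldDeriv, eq_comm (a := k), mul_comm (x k)]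

/-- Outside, the trace is a multiple of `3|x|⁻³ - 3|x|⁻⁵|x|² = 0`. The sphere itself belongs to the
outer branch, in agreement with the indicator of the open ball. -/
theorem sum_ballFieldDeriv {R : ℝ} (hR : 0 < R) (x : E3) :
    ∑ k, ballFieldDeriv R k k x = (Metric.ball (0 : E3) R).indicator 1 x := by
  by_cases h : ‖x‖ < R
  · rw [Set.indicator_of_mem (by simpa using h)]
    simp [ballFieldDeriv, h]
  · rw [Set.indicator_of_notMem (by simpa using h)]
    have hx : ‖x‖ ≠ 0 := fun h0 ↦ h (h0 ▸ hR)
    have hn : ‖x‖ ^ 2 = x 0 * x 0 + x 1 * x 1 + x 2 * x 2 := by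
      rw [EuclideanSpace.real_norm_sq_eq, Fin.sum_univ_three]
      ring
    simp only [ballFieldDeriv, h, if_false, Fin.sum_univ_three, if_true]
    have : ‖x‖⁻¹ ^ 3 = ‖x‖⁻¹ ^ 5 * ‖x‖ ^ 2 := by field_simp
    rw [this, hn]
    ring

theorem lineDeriv_ballField {R : ℝ} (hR : 0 < R) (k i : Fin 3) {x : E3} (hx : ‖x‖ ≠ R) :
    lineDeriv ℝ (ballField R k) x (basisVec i) = ballFieldDeriv R k i x := by
  have hline : HasDerivAt (fun t : ℝ ↦ x + t • basisVec i) (basisVec i) 0 := by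
    simpa using ((hasDerivAt_id (0 : ℝ)).smul_const (basisVec i)).const_add x
  have hcont : Tendsto (fun t : ℝ ↦ ‖x + t • basisVec i‖) (𝓝 0) (𝓝 ‖x‖) := by
    simpa using hline.continuousAt.norm.tendsto
  have hcoord : HasDerivAt (fun t : ℝ ↦ (x + t • basisVec i) k) (if k = i then 1 else 0) 0 := by
    have := (EuclideanSpace.proj (𝕜 := ℝ) (ι := Fin 3) k).hasFDerivAt.comp_hasDerivAt (0 : ℝ) hline
    convert! this using 1
    simp
  refine HasLineDerivAt.lineDeriv (f' := ballFieldDeriv R k i x) ?_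
  unfold HasLineDerivAt
  rcases lt_or_gt_of_ne hx with h | h
  · have h1 : HasDerivAt (fun t : ℝ ↦ 1 / 3 * (x + t • basisVec i) k) (ballFieldDeriv R k i x) 0 := by
      convert! hcoord.const_mul (1 / 3 : ℝ) using 1
      simp [ballFieldDeriv, h]
    refine h1.congr_of_eventuallyEq ?_
    filter_upwards [hcont.eventually_lt_const h] with t ht
    rw [ballField, max_eq_right ht.le]
    field_simp
  · have hx0 : 0 < ‖x‖ := hR.trans h
    have hn : HasDerivAt (fun t : ℝ ↦ ‖x + t • basisVec i‖) (x i / ‖x‖) 0 := by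
      -- The norm is differentiated as the square root of its square, which is smooth away from the
      -- origin.
      have h1 := hline.norm_sq.sqrt (by simpa using hx0.ne')
      have h2 : (fun t : ℝ ↦ √(‖x + t • basisVec i‖ ^ 2)) = fun t ↦ ‖x + t • basisVec i‖ :=
        funext fun t ↦ Real.sqrt_sq (norm_nonneg _)
      rw [h2] at h1
      convert! h1 using 1
      simp [EuclideanSpace.inner_single_right, Real.sqrt_sq]
      field_simp
    have hi := hn.fun_inv (by simpa using hx0.ne')
    have h1 := (((hi.fun_mul hi).fun_mul (hi.fun_mul hcoord)).const_mul (R ^ 3 / 3))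
    refine HasDerivAt.congr_of_eventuallyEq (f := fun t : ℝ ↦ R ^ 3 / 3 *
      ((‖x + t • basisVec i‖⁻¹ * ‖x + t • basisVec i‖⁻¹) *
        (‖x + t • basisVec i‖⁻¹ * (x + t • basisVec i) k))) ?_ ?_
    · convert! h1 using 1
      simp only [ballFieldDeriv, h.not_gt, if_false, zero_smul, add_zero]
      have := hx0.ne'
      split_ifs <;> field_simp <;> ring
    · filter_upwards [hcont.eventually_const_lt h] with t ht
      rw [ballField, max_eq_left ht.le]

theorem abs_ballFieldDeriv_le {R : ℝ} (hR : 0 < R) (k i : Fin 3) (x : E3) :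
    |ballFieldDeriv R k i x| ≤ 4 / 3 * (1 + R) ^ 3 * (1 + ‖x‖)⁻¹ ^ 3 := by
  have hx1 : 0 < 1 + ‖x‖ := by positivity
  by_cases h : ‖x‖ < R
  · have h1 : 1 ≤ (1 + R) * (1 + ‖x‖)⁻¹ := by
      rw [← div_eq_mul_inv, one_le_div hx1]
      linarith
    have h2 : 1 ≤ ((1 + R) * (1 + ‖x‖)⁻¹) ^ 3 := one_le_pow₀ h1
    rw [mul_assoc, ← mul_pow]
    simp only [ballFieldDeriv, h, if_true]
    split_ifs
    · rw [abs_of_pos (by norm_num)]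
      linarith
    · rw [abs_zero]
      positivity
  · have hx0 : 0 < ‖x‖ := hR.trans_le (not_lt.1 h)
    -- After clearing denominators this is `R ≤ ‖x‖`.
    have h1 : R * ‖x‖⁻¹ ≤ (1 + R) * (1 + ‖x‖)⁻¹ := by
      rw [← div_eq_mul_inv, ← div_eq_mul_inv, div_le_div_iff₀ hx0 hx1]
      linarith
    have h2 : (R * ‖x‖⁻¹) ^ 3 ≤ ((1 + R) * (1 + ‖x‖)⁻¹) ^ 3 := by gcongr
    have h3 : |‖x‖⁻¹ ^ 3 * (if k = i then 1 else 0) - 3 * ‖x‖⁻¹ ^ 5 * (x k * x i)| ≤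
        4 * ‖x‖⁻¹ ^ 3 := by
      refine (abs_sub _ _).trans ?_
      rw [abs_mul, abs_mul, abs_mul (x k), abs_of_pos (by positivity : 0 < ‖x‖⁻¹ ^ 3),
        abs_of_pos (by positivity : 0 < 3 * ‖x‖⁻¹ ^ 5)]
      calc _ ≤ ‖x‖⁻¹ ^ 3 * 1 + 3 * ‖x‖⁻¹ ^ 5 * (‖x‖ * ‖x‖) := by
            gcongr
            · split_ifs <;> simp
            · exact PiLp.norm_apply_le x k
            · exact PiLp.norm_apply_le x i
        _ = _ := by field_simp; ring
    simp only [ballFieldDeriv, h, if_false]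
    rw [abs_mul, abs_of_pos (by positivity : 0 < R ^ 3 / 3)]
    calc _ ≤ R ^ 3 / 3 * (4 * ‖x‖⁻¹ ^ 3) := by gcongr
      _ = 4 / 3 * (R * ‖x‖⁻¹) ^ 3 := by ring
      _ ≤ 4 / 3 * ((1 + R) * (1 + ‖x‖)⁻¹) ^ 3 := by gcongr
      _ = _ := by ring

/-- The square decays like `(1 + ‖x‖)⁻⁶`, and `6` exceeds the dimension `3`. -/
theorem memLp_ballFieldDeriv {R : ℝ} (hR : 0 < R) (k i : Fin 3) :
    MemLp (ballFieldDeriv R k i) 2 (volume : Measure E3) := by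
  have hm : Measurable (ballFieldDeriv R k i) := by
    unfold ballFieldDeriv
    exact Measurable.ite (measurableSet_lt measurable_norm measurable_const) (by fun_prop)
      (by fun_prop)
  have hg : MemLp (fun x : E3 ↦ 4 / 3 * (1 + R) ^ 3 * (1 + ‖x‖)⁻¹ ^ 3) 2 := by
    refine MemLp.const_mul ?_ _
    rw [memLp_two_iff_integrable_sq (by fun_prop)]
    have : Integrable (fun x : E3 ↦ (1 + ‖x‖) ^ (-(6 : ℝ))) :=
      integrable_one_add_norm (by simp; norm_num)
    refine this.congr (Eventually.of_forall fun x ↦ ?_)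
    have hx1 : 0 < 1 + ‖x‖ := by positivity
    dsimp only
    rw [Real.rpow_neg hx1.le, ← pow_mul, inv_pow]
    norm_cast
  refine hg.mono hm.aestronglyMeasurable (Eventually.of_forall fun x ↦ ?_)
  exact (abs_ballFieldDeriv_le hR k i x).trans (le_abs_self _)

theorem integral_ballFieldDeriv_mul_comm {R : ℝ} (hR : 0 < R) {φ : E3 → ℝ} (hφ : ContDiff ℝ ∞ φ)
    (hc : HasCompactSupport φ) (k i l : Fin 3) :
    ∫ x, ballFieldDeriv R k i x * partialDeriv l φ x =
      ∫ x, ballFieldDeriv R k l x * partialDeriv i φ x := by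
  obtain ⟨C, hC⟩ := exists_lipschitzWith_ballField hR k
  have hs : ∀ᵐ x : E3, ‖x‖ ≠ R := by
    have := Measure.addHaar_sphere (volume : Measure E3) 0 R
    rw [measure_eq_zero_iff_ae_notMem] at this
    simpa using this
  have h : ∀ a b, ∫ x, lineDeriv ℝ (ballField R k) x (basisVec a) * partialDeriv b φ x =
      ∫ x, ballFieldDeriv R k a x * partialDeriv b φ x := by
    intro a b
    refine integral_congr_ae ?_
    filter_upwards [hs] with x hx
    rw [lineDeriv_ballField hR k a hx]
  rw [← h, ← h, integral_lineDeriv_mul_partialDeriv_comm hC hφ hc]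

/-- The stray field of the ball of radius `R` with constant magnetization `σ`. -/
noncomputable def ballStrayField (R : ℝ) (σ : E3) (x : E3) : E3 :=
  ∑ i, (-∑ k, σ k * ballFieldDeriv R k i x) • basisVec i

theorem ballStrayField_apply (R : ℝ) (σ x : E3) (i : Fin 3) :
    ballStrayField R σ x i = -∑ k, σ k * ballFieldDeriv R k i x := by
  simp [ballStrayField, Finset.sum_apply, Pi.single_apply]

theorem memLp_ballStrayField {R : ℝ} (hR : 0 < R) (σ : E3) :
    MemLp (ballStrayField R σ) 2 (volume : Measure E3) := by
  refine memLp_finsetSum Finset.univ fun i _ ↦ ?_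
  refine ((ContinuousLinearMap.id ℝ ℝ).smulRight (basisVec i)).comp_memLp'
    (f := fun x ↦ -∑ k, σ k * ballFieldDeriv R k i x) ?_
  exact (memLp_finsetSum Finset.univ fun k _ ↦ (memLp_ballFieldDeriv hR k i).const_mul (σ k)).neg

theorem ballStrayField_of_mem {R : ℝ} (σ : E3) {x : E3} (hx : x ∈ Metric.ball (0 : E3) R) :
    ballStrayField R σ x = -(1 / 3 : ℝ) • σ := by
  ext i
  rw [ballStrayField_apply]
  have : ‖x‖ < R := by simpa using hx
  simp [ballFieldDeriv, this]
  ring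

/-- Let `w` be the field `ballField`. The candidate is `h = -∇(σ · w)`, so it is curl-free. As the
Jacobian of `w` is symmetric with trace `χ`, weakly `div h = -σ · ∇(div w) = -σ · ∇χ`, which cancels
`div (σ χ)`. -/
theorem isStrayField_ball {R : ℝ} (hR : 0 < R) {σ : E3} {m : L2 (Metric.ball (0 : E3) R)}
    (hm : ∀ᵐ x ∂(volume.restrict (Metric.ball (0 : E3) R)), m x = σ) :
    IsStrayField (Metric.ball 0 R) m (memLp_ballStrayField hR σ).toLp := by
  have hh := (memLp_ballStrayField hR σ).coeFn_toLp
  rw [ae_restrict_iff' measurableSet_ball] at hm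
  constructor
  · intro φ hφ hc
    have hint : ∀ k i l, Integrable (fun x ↦ ballFieldDeriv R k i x * partialDeriv l φ x) :=
      fun k i l ↦ (memLp_ballFieldDeriv hR k i).integrable_mul (memLp_partialDeriv hφ hc l)
    calc _ = ∫ x, ∑ i, ∑ k, (σ i * (ballFieldDeriv R k k x * partialDeriv i φ x) -
          σ k * (ballFieldDeriv R k i x * partialDeriv i φ x)) := by
          refine integral_congr_ae ?_
          filter_upwards [hm, hh] with x hx hhx
          have e : (Metric.ball (0 : E3) R).indicator m x = (∑ k, ballFieldDeriv R k k x) • σ := by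
            rw [sum_ballFieldDeriv hR]
            by_cases h : x ∈ Metric.ball (0 : E3) R
            · simp [Set.indicator_of_mem h, hx h]
            · simp [Set.indicator_of_notMem h]
          refine Finset.sum_congr rfl fun i _ ↦ ?_
          rw [e, hhx, PiLp.add_apply, ballStrayField_apply, PiLp.smul_apply, smul_eq_mul,
            Finset.sum_sub_distrib, add_mul, neg_mul, Finset.sum_mul, Finset.sum_mul,
            Finset.sum_mul, ← sub_eq_add_neg]
          congr 1 <;> exact Finset.sum_congr rfl fun k _ ↦ by ring
      _ = ∑ i, ∑ k, (σ i * (∫ x, ballFieldDeriv R k k x * partialDeriv i φ x) -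
          σ k * ∫ x, ballFieldDeriv R k i x * partialDeriv i φ x) := by
          have hi : ∀ i k, Integrable fun x ↦
              σ i * (ballFieldDeriv R k k x * partialDeriv i φ x) -
              σ k * (ballFieldDeriv R k i x * partialDeriv i φ x) := fun i k ↦
            ((hint k k i).const_mul _).sub ((hint k i i).const_mul _)
          rw [integral_finsetSum _ fun i _ ↦ integrable_finsetSum _ fun k _ ↦ hi i k]
          refine Finset.sum_congr rfl fun i _ ↦ ?_
          rw [integral_finsetSum _ fun k _ ↦ hi i k]
          refine Finset.sum_congr rfl fun k _ ↦ ?_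
          rw [integral_sub ((hint k k i).const_mul _) ((hint k i i).const_mul _),
            integral_const_mul, integral_const_mul]
      _ = 0 := by
          simp only [Finset.sum_sub_distrib]
          rw [sub_eq_zero]
          conv_rhs => rw [Finset.sum_comm]
          refine Finset.sum_congr rfl fun i _ ↦ Finset.sum_congr rfl fun k _ ↦ ?_
          -- In weak form, `∂ᵢ ∂ₖ wₖ = ∂ₖ ∂ᵢ wₖ = ∂ₖ ∂ₖ wᵢ`: first the derivatives are exchanged,
          -- then the symmetry of the Jacobian is used.
          rw [integral_ballFieldDeriv_mul_comm hR hφ hc, ballFieldDeriv_comm]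
  · intro φ hφ hc i j
    have hint : ∀ k i l, Integrable (fun x ↦ ballFieldDeriv R k i x * partialDeriv l φ x) :=
      fun k i l ↦ (memLp_ballFieldDeriv hR k i).integrable_mul (memLp_partialDeriv hφ hc l)
    calc _ = ∫ x, ∑ k, σ k * (ballFieldDeriv R k j x * partialDeriv i φ x -
          ballFieldDeriv R k i x * partialDeriv j φ x) := by
          refine integral_congr_ae ?_
          filter_upwards [hh] with x hhx
          rw [hhx, ballStrayField_apply, ballStrayField_apply, neg_mul, neg_mul, Finset.sum_mul,
            Finset.sum_mul, neg_sub_neg, ← Finset.sum_sub_distrib]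
          exact Finset.sum_congr rfl fun k _ ↦ by ring
      _ = 0 := by
          have hi : ∀ k, Integrable fun x ↦ σ k * (ballFieldDeriv R k j x * partialDeriv i φ x -
              ballFieldDeriv R k i x * partialDeriv j φ x) := fun k ↦
            ((hint k j i).sub (hint k i j)).const_mul _
          rw [integral_finsetSum _ fun k _ ↦ hi k]
          refine Finset.sum_eq_zero fun k _ ↦ ?_
          rw [integral_const_mul, integral_sub (hint k j i) (hint k i j),
            integral_ballFieldDeriv_mul_comm hR hφ hc, sub_self, mul_zero]

theorem strayField_ball {R : ℝ} (hR : 0 < R) {σ : E3} {m : L2 (Metric.ball (0 : E3) R)}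
    (hm : ∀ᵐ x ∂(volume.restrict (Metric.ball (0 : E3) R)), m x = σ) :
    ∀ᵐ x ∂(volume.restrict (Metric.ball (0 : E3) R)),
      strayField (Metric.ball 0 R) m x = -(1 / 3 : ℝ) • σ := by
  have h : strayField (Metric.ball 0 R) m = (memLp_ballStrayField hR σ).toLp :=
    IsStrayField.unique measurableSet_ball
      (strayField_eq measurableSet_ball m ▸ isStrayField_neg_starProjection measurableSet_ball m)
      (isStrayField_ball hR hm)
  rw [h, ae_restrict_iff' measurableSet_ball]
  filter_upwards [(memLp_ballStrayField hR σ).coeFn_toLp] with x hx hxB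
  rw [hx, ballStrayField_of_mem σ hxB]

/-! ### Lower bound for the magnetostatic energy -/

theorem inner_extendZero {Ω : Set E3} (hΩ : MeasurableSet Ω) (h : Lp E3 2 (volume : Measure E3))
    (m : L2 Ω) : inner ℝ h (extendZero hΩ m) = ∫ x in Ω, inner ℝ (h x) (m x) := by
  rw [L2.inner_def, ← integral_indicator hΩ]
  refine integral_congr_ae ?_
  filter_upwards [coeFn_extendZero hΩ m] with x hx
  rw [hx]
  by_cases h : x ∈ Ω <;> simp [h]

theorem inner_starProjection_extendZero {Ω : Set E3} (hΩ : MeasurableSet Ω) (m m' : L2 Ω) :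
    inner ℝ (gradientSpace.starProjection (extendZero hΩ m)) (extendZero hΩ m') =
      -∫ x in Ω, inner ℝ (strayField Ω m x) (m' x) := by
  rw [← inner_extendZero hΩ, strayField_eq hΩ, inner_neg_left, neg_neg]

theorem magnetostaticEnergy_eq {Ω : Set E3} (hΩ : MeasurableSet Ω) (m : L2 Ω) :
    magnetostaticEnergy Ω m =
      inner ℝ (gradientSpace.starProjection (extendZero hΩ m)) (extendZero hΩ m) :=
  (inner_starProjection_extendZero hΩ m m).symm

/-- Expands `⟨P (m - c), m - c⟩ ≥ 0`, which holds because `P` is self-adjoint and idempotent. -/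
theorem two_mul_inner_le_magnetostaticEnergy {Ω : Set E3} (hΩ : MeasurableSet Ω) (m c : L2 Ω) :
    -2 * (∫ x in Ω, inner ℝ (strayField Ω c x) (m x)) - magnetostaticEnergy Ω c ≤
      magnetostaticEnergy Ω m := by
  set P := gradientSpace.starProjection with hP
  have hsymm : ∀ u v, inner ℝ (P u) v = inner ℝ u (P v) := fun u v ↦
    Submodule.inner_starProjection_left_eq_right _ u v
  have hnn : ∀ u, 0 ≤ inner ℝ (P u) u := fun u ↦ by
    have : P (P u) = P u := Submodule.starProjection_eq_self_iff.2
      (Submodule.starProjection_apply_mem _ _)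
    rw [← this, hsymm]
    exact real_inner_self_nonneg
  have h0 := hnn (extendZero hΩ m - extendZero hΩ c)
  have h1 := inner_starProjection_extendZero hΩ c m
  rw [← hP] at h1
  rw [magnetostaticEnergy_eq hΩ, magnetostaticEnergy_eq hΩ, ← hP]
  rw [map_sub, inner_sub_left, inner_sub_right, inner_sub_right, hsymm (extendZero hΩ m)
    (extendZero hΩ c), real_inner_comm (P (extendZero hΩ c)) (extendZero hΩ m)] at h0
  linarith

instance isFiniteMeasure_restrict_ball (R : ℝ) :
    IsFiniteMeasure (volume.restrict (Metric.ball (0 : E3) R)) :=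
  ⟨by rw [Measure.restrict_apply_univ]; exact measure_ball_lt_top⟩

variable {R : ℝ}

theorem integrable_of_L2_ball (m : L2 (Metric.ball (0 : E3) R)) :
    Integrable m (volume.restrict (Metric.ball (0 : E3) R)) :=
  (Lp.memLp m).integrable one_le_two

theorem integral_inner_strayField_ball (hR : 0 < R) {σ : E3} {c : L2 (Metric.ball (0 : E3) R)}
    (hc : ∀ᵐ x ∂(volume.restrict (Metric.ball (0 : E3) R)), c x = σ)
    (m : L2 (Metric.ball (0 : E3) R)) :
    ∫ x in Metric.ball (0 : E3) R, inner ℝ (strayField (Metric.ball 0 R) c x) (m x) =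
      -(1 / 3) * inner ℝ σ (∫ x in Metric.ball (0 : E3) R, m x) := by
  rw [← integral_inner (integrable_of_L2_ball m), ← integral_const_mul]
  refine integral_congr_ae ?_
  filter_upwards [strayField_ball hR hc] with x hx
  rw [hx, inner_smul_left]
  simp

theorem magnetostaticEnergy_const (hR : 0 < R) {σ : E3} {c : L2 (Metric.ball (0 : E3) R)}
    (hc : ∀ᵐ x ∂(volume.restrict (Metric.ball (0 : E3) R)), c x = σ) :
    magnetostaticEnergy (Metric.ball 0 R) c =
      1 / 3 * (volume.real (Metric.ball (0 : E3) R) * ‖σ‖ ^ 2) := by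
  rw [magnetostaticEnergy, integral_inner_strayField_ball hR hc, integral_congr_ae hc,
    setIntegral_const, inner_smul_right, real_inner_self_eq_norm_sq]
  ring

theorem volume_real_ball_pos (hR : 0 < R) : 0 < volume.real (Metric.ball (0 : E3) R) :=
  ENNReal.toReal_pos (Metric.measure_ball_pos _ _ hR).ne' measure_ball_lt_top.ne

/-- A field which is almost everywhere constant in the ball. -/
theorem exists_ae_eq_const (R : ℝ) (σ : E3) : ∃ c : L2 (Metric.ball (0 : E3) R),
    ∀ᵐ x ∂(volume.restrict (Metric.ball (0 : E3) R)), c x = σ :=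
  ⟨Lp.const 2 _ σ, Lp.coeFn_const ..⟩

/-- The magnetostatic energy is at least that of the average magnetization. -/
theorem le_magnetostaticEnergy (hR : 0 < R) (m : L2 (Metric.ball (0 : E3) R)) :
    ‖∫ x in Metric.ball (0 : E3) R, m x‖ ^ 2 / (3 * volume.real (Metric.ball (0 : E3) R)) ≤
      magnetostaticEnergy (Metric.ball 0 R) m := by
  set V := volume.real (Metric.ball (0 : E3) R) with hV
  set M := ∫ x in Metric.ball (0 : E3) R, m x with hM
  have hV0 : 0 < V := volume_real_ball_pos hR
  -- For constant `σ` the tangent bound is `(2/3) ⟨σ, M⟩ - (V/3) ‖σ‖²`, maximal at `σ = M / V`.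
  obtain ⟨c, hc⟩ := exists_ae_eq_const R (V⁻¹ • M)
  have h := two_mul_inner_le_magnetostaticEnergy measurableSet_ball m c
  rw [integral_inner_strayField_ball hR hc, magnetostaticEnergy_const hR hc, ← hM, ← hV,
    norm_smul, inner_smul_left, real_inner_self_eq_norm_sq, norm_inv, Real.norm_of_nonneg hV0.le]
    at h
  refine le_trans (le_of_eq ?_) h
  simp
  field_simp
  ring

/-! ### Lower bound for the exchange energy -/

theorem integral_norm_sub_sq {m : L2 (Metric.ball (0 : E3) R)}
    (hm : m ∈ L2Sphere (Metric.ball 0 R)) (v : E3) :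
    Integrable (fun y ↦ ‖v - m y‖ ^ 2) (volume.restrict (Metric.ball (0 : E3) R)) ∧
    ∫ y in Metric.ball (0 : E3) R, ‖v - m y‖ ^ 2 =
      volume.real (Metric.ball (0 : E3) R) * (‖v‖ ^ 2 + 1) -
        2 * inner ℝ v (∫ x in Metric.ball (0 : E3) R, m x) := by
  have hi := integrable_of_L2_ball m
  have hi2 : Integrable (fun y ↦ 2 * inner ℝ v (m y))
    (volume.restrict (Metric.ball (0 : E3) R)) := (hi.const_inner v).const_mul 2
  have e : (fun y ↦ ‖v - m y‖ ^ 2) =ᵐ[volume.restrict (Metric.ball (0 : E3) R)]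
      fun y ↦ (‖v‖ ^ 2 + 1) - 2 * inner ℝ v (m y) := by
    have hm' : ∀ᵐ x ∂(volume.restrict (Metric.ball (0 : E3) R)),
      m x ∈ Metric.sphere (0 : E3) 1 := hm
    filter_upwards [hm'] with y hy
    rw [mem_sphere_zero_iff_norm] at hy
    rw [norm_sub_sq_real, hy]
    ring
  refine ⟨((integrable_const _).sub hi2).congr e.symm, ?_⟩
  rw [integral_congr_ae e, integral_sub (integrable_const _) hi2, integral_const_mul,
    integral_inner hi, setIntegral_const, smul_eq_mul]

theorem norm_integral_le_volume {m : L2 (Metric.ball (0 : E3) R)}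
    (hm : m ∈ L2Sphere (Metric.ball 0 R)) :
    ‖∫ x in Metric.ball (0 : E3) R, m x‖ ≤ volume.real (Metric.ball (0 : E3) R) := by
  have := norm_setIntegral_le_of_norm_le_const_ae (μ := volume) (C := 1) (f := m)
    (s := Metric.ball (0 : E3) R) measure_ball_lt_top ?_
  · simpa using this
  · have hm' : ∀ᵐ x ∂(volume.restrict (Metric.ball (0 : E3) R)),
      m x ∈ Metric.sphere (0 : E3) 1 := hm
    filter_upwards [hm'] with x hx
    exact (mem_sphere_zero_iff_norm.1 hx).le

/-- For unit vectors `|m(x) - m(y)|² = 2 - 2 ⟨m(x), m(y)⟩`, and the double integral of the inner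
product is `‖M‖²`. -/
theorem lintegral_lintegral_norm_sub_sq {m : L2 (Metric.ball (0 : E3) R)}
    (hm : m ∈ L2Sphere (Metric.ball 0 R)) :
    ∫⁻ x in Metric.ball (0 : E3) R, ∫⁻ y in Metric.ball (0 : E3) R, ‖m x - m y‖ₑ ^ 2 =
      ENNReal.ofReal (2 * (volume.real (Metric.ball (0 : E3) R) ^ 2 -
        ‖∫ x in Metric.ball (0 : E3) R, m x‖ ^ 2)) := by
  set V := volume.real (Metric.ball (0 : E3) R) with hV
  set M := ∫ x in Metric.ball (0 : E3) R, m x with hM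
  have hm' : ∀ᵐ x ∂(volume.restrict (Metric.ball (0 : E3) R)),
    m x ∈ Metric.sphere (0 : E3) 1 := hm
  have h1 : ∀ v : E3, ∫⁻ y in Metric.ball (0 : E3) R, ‖v - m y‖ₑ ^ 2 =
      ENNReal.ofReal (V * (‖v‖ ^ 2 + 1) - 2 * inner ℝ v M) := by
    intro v
    obtain ⟨hi, he⟩ := integral_norm_sub_sq hm v
    rw [← he, ofReal_integral_eq_lintegral_ofReal hi (Eventually.of_forall fun y ↦ by positivity)]
    refine lintegral_congr fun y ↦ ?_
    rw [ENNReal.ofReal_pow (norm_nonneg _), ofReal_norm]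
  have hi := integrable_of_L2_ball m
  have hi2 : Integrable (fun y ↦ 2 * inner ℝ (m y) M)
    (volume.restrict (Metric.ball (0 : E3) R)) := (hi.inner_const M).const_mul 2
  have e : (fun x ↦ V * (‖m x‖ ^ 2 + 1) - 2 * inner ℝ (m x) M)
      =ᵐ[volume.restrict (Metric.ball (0 : E3) R)] fun x ↦ 2 * V - 2 * inner ℝ (m x) M := by
    filter_upwards [hm'] with x hx
    rw [mem_sphere_zero_iff_norm.1 hx]
    ring
  have hint := ((integrable_const (2 * V)).sub hi2).congr e.symm
  simp_rw [h1]
  rw [← ofReal_integral_eq_lintegral_ofReal hint, integral_congr_ae e,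
    integral_sub (integrable_const _) hi2, integral_const_mul 2 (fun x ↦ inner ℝ (m x) M),
    setIntegral_const, ← hV]
  · congr 1
    have : ∫ x in Metric.ball (0 : E3) R, inner ℝ (m x) M = inner ℝ M M := by
      simp_rw [real_inner_comm M]
      exact integral_inner hi M
    rw [this, real_inner_self_eq_norm_sq, smul_eq_mul]
    ring
  · filter_upwards with x
    obtain ⟨-, he⟩ := integral_norm_sub_sq hm (m x)
    rw [← hM, ← hV] at he
    rw [← he]
    exact integral_nonneg fun y ↦ by positivity

/-- The Poincaré-type inequality for the nonlocal exchange energy. -/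
theorem kernelInf_mul_le_exchangeEnergy (hR : 0 < R) (j : E3 → ℝ≥0∞)
    (m : L2 (Metric.ball (0 : E3) R)) :
    kernelInf j (Metric.ball 0 R) *
      ∫⁻ x in Metric.ball (0 : E3) R, ∫⁻ y in Metric.ball (0 : E3) R, ‖m x - m y‖ₑ ^ 2 ≤
      exchangeEnergy j (Metric.ball 0 R) m := by
  set Q := kernelInf j (Metric.ball 0 R) with hQ
  have hae : ∀ᵐ z : E3, ‖z‖ < 2 * R → Q ≤ j z := by
    have := ae_essInf_le (f := j)
      (μ := volume.restrict {z : E3 | ‖z‖ < Metric.diam (Metric.ball (0 : E3) R)})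
    rw [ae_restrict_iff' (measurableSet_lt measurable_norm measurable_const), Metric.diam_ball_eq _ hR.le]
      at this
    simpa [hQ, kernelInf, Metric.diam_ball_eq _ hR.le] using this
  have hmeas := (Lp.stronglyMeasurable m).measurable
  have hm1 : Measurable fun p : E3 × E3 ↦ ‖m p.1 - m p.2‖ₑ ^ 2 := by fun_prop
  rw [exchangeEnergy, ← lintegral_const_mul _ hm1.lintegral_prod_right']
  refine lintegral_mono_ae ?_
  filter_upwards [ae_restrict_mem measurableSet_ball] with x hx
  rw [← lintegral_const_mul _ (by fun_prop)]
  refine lintegral_mono_ae ?_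
  -- For fixed `x` the map `y ↦ x - y` preserves volume, so the exceptional null set of the
  -- essential infimum pulls back to a null set of `y`.
  have hxy := (Measure.measurePreserving_sub_left (volume : Measure E3) x).quasiMeasurePreserving.ae hae
  filter_upwards [ae_restrict_mem measurableSet_ball, ae_restrict_of_ae hxy] with y hy h
  gcongr
  refine h ((norm_sub_le _ _).trans_lt ?_)
  rw [mem_ball_zero_iff] at hx hy
  linarith

/-- The integrand is `j * 0`, which is `0` in `ℝ≥0∞` even where `j` is infinite. -/
theorem exchangeEnergy_const (j : E3 → ℝ≥0∞) {Ω : Set E3} {σ : E3} {m : L2 Ω}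
    (hm : ∀ᵐ x ∂(volume.restrict Ω), m x = σ) : exchangeEnergy j Ω m = 0 := by
  rw [exchangeEnergy, ← lintegral_zero (μ := volume.restrict Ω)]
  refine lintegral_congr_ae ?_
  filter_upwards [hm] with x hx
  rw [← lintegral_zero (μ := volume.restrict Ω)]
  refine lintegral_congr_ae ?_
  filter_upwards [hm] with y hy
  simp [hx, hy]

theorem le_kernelInf (hR : 0 < R) {j : E3 → ℝ≥0∞}
    (hC : poincareConst j (Metric.ball 0 R) < 3) :
    ENNReal.ofReal (1 / (3 * volume.real (Metric.ball (0 : E3) R))) ≤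
      kernelInf j (Metric.ball 0 R) := by
  have hV0 : 0 < volume.real (Metric.ball (0 : E3) R) := volume_real_ball_pos hR
  by_contra! h
  refine hC.not_ge ?_
  have hvol : volume (Metric.ball (0 : E3) R) =
      ENNReal.ofReal (volume.real (Metric.ball (0 : E3) R)) :=
    (ENNReal.ofReal_toReal measure_ball_lt_top.ne).symm
  rw [poincareConst, one_div, ENNReal.le_inv_iff_le_inv]
  calc kernelInf j (Metric.ball 0 R) * volume (Metric.ball (0 : E3) R)
      ≤ ENNReal.ofReal (1 / (3 * volume.real (Metric.ball (0 : E3) R))) *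
        ENNReal.ofReal (volume.real (Metric.ball (0 : E3) R)) := by rw [← hvol]; gcongr
    _ = ENNReal.ofReal (3⁻¹) := by
      rw [← ENNReal.ofReal_mul (by positivity)]
      congr 1
      field_simp
    _ = 3⁻¹ := by rw [ENNReal.ofReal_inv_of_pos (by norm_num)]; simp

/-! ### The energy bound and its equality case -/

/-- The exchange bound contributes `2 (V² - ‖M‖²) / (3V)` and the magnetostatic bound `‖M‖² / (3V)`.
The factor `2` leaves a positive multiple of `V² - ‖M‖²`, so `Q ≥ 1/(3V)` without strictness is
enough for rigidity. -/
theorem le_energy (hR : 0 < R) {j : E3 → ℝ≥0∞}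
    (hC : poincareConst j (Metric.ball 0 R) < 3) {m : L2 (Metric.ball (0 : E3) R)}
    (hm : m ∈ admissible j (Metric.ball 0 R)) :
    1 / 3 * volume.real (Metric.ball (0 : E3) R) +
      (volume.real (Metric.ball (0 : E3) R) ^ 2 - ‖∫ x in Metric.ball (0 : E3) R, m x‖ ^ 2) /
        (3 * volume.real (Metric.ball (0 : E3) R)) ≤ energy j (Metric.ball 0 R) m := by
  have hW := le_magnetostaticEnergy hR m
  have hJ := kernelInf_mul_le_exchangeEnergy hR j m
  rw [lintegral_lintegral_norm_sub_sq hm.1] at hJ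
  have hV0 : 0 < volume.real (Metric.ball (0 : E3) R) := volume_real_ball_pos hR
  have hJ' := (mul_le_mul_left (le_kernelInf hR hC) _).trans hJ
  rw [← ENNReal.ofReal_mul (by positivity)] at hJ'
  -- Admissibility matters here: an infinite exchange energy would be turned into `0` by `toReal`.
  have hJ2 := (ENNReal.ofReal_le_iff_le_toReal hm.2.ne).1 hJ'
  refine le_trans (le_of_eq ?_) (add_le_add hJ2 hW)
  field_simp
  ring

theorem energy_const (hR : 0 < R) (j : E3 → ℝ≥0∞) {σ : E3} (hσ : σ ∈ Metric.sphere (0 : E3) 1)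
    {m : L2 (Metric.ball (0 : E3) R)}
    (hm : ∀ᵐ x ∂(volume.restrict (Metric.ball (0 : E3) R)), m x = σ) :
    m ∈ admissible j (Metric.ball 0 R) ∧
      energy j (Metric.ball 0 R) m = 1 / 3 * volume.real (Metric.ball (0 : E3) R) := by
  refine ⟨⟨?_, by simp [exchangeEnergy_const j hm]⟩, ?_⟩
  · exact hm.mono fun x hx ↦ hx ▸ hσ
  · rw [energy, exchangeEnergy_const j hm, magnetostaticEnergy_const hR hm,
      mem_sphere_zero_iff_norm.1 hσ]
    simp

/-- The bound forces `‖M‖ = V`, the equality case of `‖∫ m‖ ≤ ∫ ‖m‖`; it is settled by computing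
that the mean square distance of `m` to `M / V` is zero. -/
theorem ae_eq_const_of_energy_le (hR : 0 < R) {j : E3 → ℝ≥0∞}
    (hC : poincareConst j (Metric.ball 0 R) < 3) {m : L2 (Metric.ball (0 : E3) R)}
    (hm : m ∈ admissible j (Metric.ball 0 R))
    (hE : energy j (Metric.ball 0 R) m ≤ 1 / 3 * volume.real (Metric.ball (0 : E3) R)) :
    ∃ σ ∈ Metric.sphere (0 : E3) 1,
      ∀ᵐ x ∂(volume.restrict (Metric.ball (0 : E3) R)), m x = σ := by
  set V := volume.real (Metric.ball (0 : E3) R) with hV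
  set M := ∫ x in Metric.ball (0 : E3) R, m x with hM
  have hV0 : 0 < V := volume_real_ball_pos hR
  have h1 := (le_energy hR hC hm).trans hE
  rw [← hV, ← hM] at h1
  have h2 : (V ^ 2 - ‖M‖ ^ 2) / (3 * V) ≤ 0 := by linarith
  have h3 : V ^ 2 - ‖M‖ ^ 2 ≤ 0 := by
    rwa [div_le_iff₀ (by positivity), zero_mul] at h2
  have h4 : ‖M‖ = V := le_antisymm (norm_integral_le_volume hm.1)
    (abs_le_of_sq_le_sq' (by linarith) (norm_nonneg _)).2
  have hσ : ‖V⁻¹ • M‖ = 1 := by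
    rw [norm_smul, norm_inv, Real.norm_of_nonneg hV0.le, h4, inv_mul_cancel₀ hV0.ne']
  refine ⟨V⁻¹ • M, mem_sphere_zero_iff_norm.2 hσ, ?_⟩
  obtain ⟨hi, he⟩ := integral_norm_sub_sq hm.1 (V⁻¹ • M)
  have h5 : ∫ y in Metric.ball (0 : E3) R, ‖V⁻¹ • M - m y‖ ^ 2 = 0 := by
    rw [he, ← hV, ← hM, hσ, inner_smul_left, real_inner_self_eq_norm_sq, h4]
    simp
    field_simp
    ring
  rw [integral_eq_zero_iff_of_nonneg (fun y ↦ by positivity) hi] at h5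
  filter_upwards [h5] with x hx
  have : ‖V⁻¹ • M - m x‖ ^ 2 = 0 := hx
  exact (sub_eq_zero.1 (norm_eq_zero.1 (pow_eq_zero_iff (by norm_num) |>.1 this))).symm

end Micromagnetics

theorem mainTheorem5 (R : ℝ) (hR : 0 < R)
    (j : Micromagnetics.E3 → ℝ≥0∞) (hj : Measurable j) (hfin : ∀ᵐ z, j z < ⊤)
    (hQ : 0 < Micromagnetics.kernelInf j (Metric.ball 0 R))
    (hC : Micromagnetics.poincareConst j (Metric.ball 0 R) < 3) :
    -- the demagnetizing field is well defined
    (∀ m : Micromagnetics.L2 (Metric.ball 0 R),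
      ∃! h, Micromagnetics.IsStrayField (Metric.ball 0 R) m h) ∧
    -- a minimizer exists
    (∃ m, Micromagnetics.IsMinimizer j (Metric.ball 0 R) m) ∧
    -- the minimizers are exactly the constant maps with values in the unit sphere
    (∀ m, Micromagnetics.IsMinimizer j (Metric.ball 0 R) m ↔
      ∃ σ ∈ Metric.sphere (0 : Micromagnetics.E3) 1,
        ∀ᵐ x ∂(volume.restrict (Metric.ball 0 R)), m x = σ) := by
  have hmin : ∀ m : Micromagnetics.L2 (Metric.ball 0 R),
      ∀ σ ∈ Metric.sphere (0 : Micromagnetics.E3) 1,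
      (∀ᵐ x ∂(volume.restrict (Metric.ball 0 R)), m x = σ) →
      Micromagnetics.IsMinimizer j (Metric.ball 0 R) m := by
    intro m σ hσ hm
    obtain ⟨hadm, hE⟩ := Micromagnetics.energy_const hR j hσ hm
    refine ⟨hadm, fun m' hm' ↦ ?_⟩
    have h1 := Micromagnetics.le_energy hR hC hm'
    have h2 := Micromagnetics.norm_integral_le_volume hm'.1
    have hV := Micromagnetics.volume_real_ball_pos hR
    rw [Set.mem_ofPred_eq, hE]
    refine le_trans (le_add_of_nonneg_right (div_nonneg ?_ (by positivity))) h1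
    exact sub_nonneg.2 (by gcongr)
  have hσ₀ : Micromagnetics.basisVec 0 ∈ Metric.sphere (0 : Micromagnetics.E3) 1 := by simp
  obtain ⟨c, hc⟩ := Micromagnetics.exists_ae_eq_const R (Micromagnetics.basisVec 0)
  refine ⟨fun m ↦ ⟨_, Micromagnetics.isStrayField_neg_starProjection measurableSet_ball m,
    fun h hh ↦ hh.unique measurableSet_ball
      (Micromagnetics.isStrayField_neg_starProjection measurableSet_ball m)⟩,
    ⟨c, hmin c _ hσ₀ hc⟩, fun m ↦ ⟨fun hm ↦ ?_, fun ⟨σ, hσ, hm⟩ ↦ hmin m σ hσ hm⟩⟩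
  obtain ⟨hadm, hE⟩ := Micromagnetics.energy_const hR j hσ₀ hc
  -- A minimizer does no worse than the constant `c`, whose energy is `V/3`.
  exact Micromagnetics.ae_eq_const_of_energy_le hR hC hm.1 (hE ▸ hm.2 hadm)
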